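/- Let $n\ge 1$ be an integer, let $r_1,\dots,r_n>0$ be real numbers, let $a<b$, and let $w:[a,b]\to[0,\infty)$ be upper semicontinuous. Assume that $w$ is non-zero at more than $n$ points of $[a,b]$, where each point of $(a,b)$ is counted with weight $1$ and each of the endpoints $a,b$ with weight $1/2$. Write $\|f\|_w:=\sup_{t\in[a,b]}|f(t)|\,w(t)$ and consider the classes of generalized algebraic polynomials $$\mathcal P_{\mathbf r}[a,b]:=\Big\{\prod_{j=1}^n|t-x_j|^{r_j}\ :\ a\le x_1\le\dots\le x_n\le b\Big\},$$ $$\mathcal P_{\mathbf r}:=\Big\{\prod_{j=1}^n|t-(x_j+iy_j)|^{r_j}\ :\ -\infty<x_1\le\dots\le x_n<\infty,\ y_1,\dots,y_n\in\mathbb R\Big\}.$$ Let $R:=\inf_{Q\in\mathcal P_{\mathbf r}[a,b]}\|Q\|_w$ be the restricted and $C:=\inf_{Q\in\mathcal P_{\mathbf r}}\|Q\|_w$ the unrestricted Bojanov–Chebyshev constant. Then: 1. $C=R$, and there is exactly one $P\in\mathcal P_{\mathbf r}$ with $\|P\|_w=C$. It belongs to $\mathcal P_{\mathbf r}[a,b]$,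 where it is therefore also the unique $P$ with $\|P\|_w=R$. It has the form $P(t)=\prod_{j=1}^n|t-x_j^*|^{r_j}$ with $a<x_1^*<\dots<x_n^*<b$, and $(x_1^*,\dots,x_n^*)$ is the only node system in $\{a\le x_1\le\dots\le x_n\le b\}$ that gives an extremal element. 2. $(x_1^*,\dots,x_n^*)$ is the only node system $a\le x_1\le\dots\le x_n\le b$ with the following property: with $Q(t)=\prod_{j=1}^n|t-x_j|^{r_j}$, there are points $a\le t_0<x_1<t_1<x_2<\dots<x_n<t_n\le b$ such that $Q(t_k)w(t_k)=\|Q\|_w$ for $k=0,1,\dots,n$. 3. If in addition $w$ is log-concave on $[a,b]$, that is, $w(\alpha s+\beta t)\ge w(s)^\alpha w(t)^\beta$ for all $s,t\in[a,b]$ and $\alpha,\beta>0$ with $\alpha+\beta=1$, then $(x_1^*,\dots,x_n^*)$ is the only node system $a\le x_1\le\dots\le x_n\le b$ with the following property: with $Q(t)=\prod_{j=1}^n|t-x_j|^{r_j}$, there are $n+1$ points $a\le t_0<t_1<\dots<t_n\le b$ such that $Q(t_k)w(t_k)=\|Q\|_w$ for $k=0,1,\dots,n$. -/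

import Mathlib

open Set
open scoped ENNReal

noncomputable section

/-- The `w`-weighted uniform norm `sup_{t ∈ [a,b]} |f t| * w t`. -/
def weightedNorm (a b : ℝ) (w f : ℝ → ℝ) : ℝ :=
  sSup ((fun t => |f t| * w t) '' Icc a b)

/-- The number of points of `A` in `[a,b]`, where points of `(a,b)` count `1` and each of the
endpoints `a`, `b` counts `1/2`. -/
def weightedCount (a b : ℝ) (A : Set ℝ) : ℝ≥0∞ :=
  ((A ∩ Ioo a b).encard : ℝ≥0∞) + ((A ∩ {a, b}).encard : ℝ≥0∞) / 2

/-- The node systems `a ≤ x₁ ≤ ⋯ ≤ xₙ ≤ b`. -/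
def closedSimplex (n : ℕ) (a b : ℝ) : Set (Fin n → ℝ) :=
  {x | Monotone x ∧ ∀ j, x j ∈ Icc a b}

/-- The node systems `a < x₁ < ⋯ < xₙ < b`. -/
def openSimplex (n : ℕ) (a b : ℝ) : Set (Fin n → ℝ) :=
  {x | StrictMono x ∧ ∀ j, x j ∈ Ioo a b}

/-- The monic generalized algebraic polynomial `∏ |t - xⱼ| ^ rⱼ`. -/
def gap {n : ℕ} (r x : Fin n → ℝ) (t : ℝ) : ℝ :=
  ∏ j, |t - x j| ^ r j

/-- The generalized algebraic polynomial `∏ |t - (xⱼ + i yⱼ)| ^ rⱼ` with complex zeros. -/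
def complexGap {n : ℕ} (r x y : Fin n → ℝ) (t : ℝ) : ℝ :=
  ∏ j, ‖(t : ℂ) - ((x j : ℂ) + Complex.I * (y j : ℂ))‖ ^ r j

/-- The restricted class: all zeros lie in `[a,b]`, in the order of the exponents. -/
def restrictedGAP {n : ℕ} (r : Fin n → ℝ) (a b : ℝ) : Set (ℝ → ℝ) :=
  {P | ∃ x ∈ closedSimplex n a b, P = gap r x}

/-- The unrestricted class: complex zeros, whose real parts are in the order of the exponents. -/
def unrestrictedGAP {n : ℕ} (r : Fin n → ℝ) : Set (ℝ → ℝ) :=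
  {P | ∃ x y : Fin n → ℝ, Monotone x ∧ P = complexGap r x y}

/-- The infimum of the weighted norm over a class of functions. -/
def chebyshevConstant (a b : ℝ) (w : ℝ → ℝ) (𝓕 : Set (ℝ → ℝ)) : ℝ :=
  sInf (weightedNorm a b w '' 𝓕)

/-- `P` is an extremal element (of least weighted norm) of the class `𝓕`. -/
def IsExtremalIn (a b : ℝ) (w : ℝ → ℝ) (𝓕 : Set (ℝ → ℝ)) (P : ℝ → ℝ) : Prop :=
  P ∈ 𝓕 ∧ ∀ Q ∈ 𝓕, weightedNorm a b w P ≤ weightedNorm a b w Q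

/-- `P * w` attains the weighted norm of `P` at each of the points `t 0, …, t n`. -/
def AttainsNormAt {n : ℕ} (a b : ℝ) (w P : ℝ → ℝ) (t : Fin (n + 1) → ℝ) : Prop :=
  ∀ k, P (t k) * w (t k) = weightedNorm a b w P

/-- `a ≤ t₀ < x₁ < t₁ < x₂ < ⋯ < xₙ < tₙ ≤ b`. -/
def Interlaces {n : ℕ} (a b : ℝ) (x : Fin n → ℝ) (t : Fin (n + 1) → ℝ) : Prop :=
  (∀ k, t k ∈ Icc a b) ∧ ∀ j : Fin n, t j.castSucc < x j ∧ x j < t j.succ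

/-- Logarithmic concavity on `[a,b]` of a non-negative function, zero values being allowed. -/
def LogConcaveOnIcc (a b : ℝ) (w : ℝ → ℝ) : Prop :=
  ∀ s ∈ Icc a b, ∀ t ∈ Icc a b, ∀ α β : ℝ, 0 < α → 0 < β → α + β = 1 →
    w s ^ α * w t ^ β ≤ w (α * s + β * t)

end

section

open Filter Topology

/-! ### Semicontinuity, existence of minimizers, and projection of complex zeros to `[a,b]` -/

section Basics

variable {n : ℕ} {r : Fin n → ℝ} {a b : ℝ} {w : ℝ → ℝ}

/-! A minimizer exists by compactness of the closed simplex, and projecting zeros to `[a,b]` never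
raises the norm, so the restricted and unrestricted problems agree.

At a minimizer, `log u ≤ u - 1` rules out every node motion whose first-order effect on the
logarithm is nonpositive near all maximum points. Pulling two nodes apart, or moving one node alone,
then forces a maximum point between neighbouring nodes and beyond the outer ones: this is
`exists_interlaces_of_minimal`.

For uniqueness, suppose `x` and `y` both interlace the same `t` and `y` is nowhere larger on `t`. If
`y ≠ x`, some sum of simple fractions is positive at every `t k`; but a combination of these values
with positive weights is a divided difference of order `n` of a polynomial of degree below `n`,
hence zero. A competitor `y` that does not interlace is reached by applying the existence part to an
auxiliary weight supported on the points `t k` (`Interlaces.eq_of_gap_le_of_mem_closedSimplex`).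

For log-concave `w`, strict log-concavity of the polynomial between nodes puts a node between any
two maximum points, so attainment already implies interlacing. -/

lemma gap_nonneg (r x : Fin n → ℝ) (t : ℝ) : 0 ≤ gap r x t :=
  Finset.prod_nonneg fun _ _ => Real.rpow_nonneg (abs_nonneg _) _

lemma gap_pos {x : Fin n → ℝ} {t : ℝ} (h : ∀ j, t ≠ x j) : 0 < gap r x t :=
  Finset.prod_pos fun j _ => Real.rpow_pos_of_pos (abs_pos.2 (sub_ne_zero.2 (h j))) _

lemma gap_eq_zero (hr : ∀ j, 0 < r j) {x : Fin n → ℝ} {t : ℝ} {j : Fin n} (h : t = x j) :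
    gap r x t = 0 :=
  Finset.prod_eq_zero (Finset.mem_univ j) (by simp [h, Real.zero_rpow (hr j).ne'])

lemma ne_node_of_gap_pos (hr : ∀ j, 0 < r j) {x : Fin n → ℝ} {t : ℝ} (h : 0 < gap r x t)
    (j : Fin n) : t ≠ x j :=
  fun e => h.ne' (gap_eq_zero hr e)

lemma log_gap {x : Fin n → ℝ} {t : ℝ} (h : ∀ j, t ≠ x j) :
    Real.log (gap r x t) = ∑ j, r j * Real.log (t - x j) := by
  unfold gap
  rw [Real.log_prod fun j _ =>
    (Real.rpow_pos_of_pos (abs_pos.2 (sub_ne_zero.2 (h j))) _).ne']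
  refine Finset.sum_congr rfl fun j _ => ?_
  rw [Real.log_rpow (abs_pos.2 (sub_ne_zero.2 (h j))), Real.log_abs]

lemma continuous_gap (hr : ∀ j, 0 < r j) :
    Continuous fun p : (Fin n → ℝ) × ℝ => gap r p.1 p.2 := by
  unfold gap
  refine continuous_finsetProd _ fun j _ => ?_
  exact Continuous.rpow_const (by fun_prop) fun _ => Or.inr (hr j).le

lemma continuous_gap_right (hr : ∀ j, 0 < r j) (x : Fin n → ℝ) : Continuous (gap r x) :=
  (continuous_gap hr).comp (by fun_prop : Continuous fun t : ℝ => (x, t))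

lemma continuous_gap_left (hr : ∀ j, 0 < r j) (t : ℝ) : Continuous fun x => gap r x t :=
  (continuous_gap hr).comp (by fun_prop : Continuous fun x : Fin n → ℝ => (x, t))

lemma mul_le_weightedNorm {f : ℝ → ℝ} (hf : ContinuousOn f (Icc a b))
    (hw0 : ∀ t ∈ Icc a b, 0 ≤ w t) (hw : UpperSemicontinuousOn w (Icc a b))
    {t : ℝ} (ht : t ∈ Icc a b) : |f t| * w t ≤ weightedNorm a b w f := by
  obtain ⟨B, hB⟩ := hw.bddAbove_of_isCompact isCompact_Icc
  obtain ⟨C, hC⟩ := isCompact_Icc.bddAbove_image hf.abs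
  refine le_csSup ⟨C * B, ?_⟩ ⟨t, ht, rfl⟩
  rintro _ ⟨s, hs, rfl⟩
  have h1 : |f s| ≤ C := hC ⟨s, hs, rfl⟩
  exact mul_le_mul h1 (hB ⟨s, hs, rfl⟩) (hw0 s hs) ((abs_nonneg _).trans h1)

lemma weightedNorm_le {f : ℝ → ℝ} {c : ℝ} (hab : a < b)
    (h : ∀ t ∈ Icc a b, |f t| * w t ≤ c) : weightedNorm a b w f ≤ c := by
  refine csSup_le ((nonempty_Icc.2 hab.le).image _) ?_
  rintro _ ⟨s, hs, rfl⟩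
  exact h s hs

lemma weightedNorm_mono {f g : ℝ → ℝ} (hab : a < b) (hg : ContinuousOn g (Icc a b))
    (hw0 : ∀ t ∈ Icc a b, 0 ≤ w t) (hw : UpperSemicontinuousOn w (Icc a b))
    (h : ∀ t ∈ Icc a b, |f t| ≤ |g t|) : weightedNorm a b w f ≤ weightedNorm a b w g :=
  weightedNorm_le hab fun t ht =>
    (mul_le_mul_of_nonneg_right (h t ht) (hw0 t ht)).trans (mul_le_weightedNorm hg hw0 hw ht)

lemma gap_mul_le (hr : ∀ j, 0 < r j) (hw0 : ∀ t ∈ Icc a b, 0 ≤ w t)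
    (hw : UpperSemicontinuousOn w (Icc a b)) (x : Fin n → ℝ) {t : ℝ} (ht : t ∈ Icc a b) :
    gap r x t * w t ≤ weightedNorm a b w (gap r x) := by
  have := mul_le_weightedNorm (continuous_gap_right hr x).continuousOn hw0 hw ht
  rwa [abs_of_nonneg (gap_nonneg r x t)] at this

/-- Joint upper semicontinuity of the weighted generalized polynomial in nodes and argument. -/
lemma eventually_gap_mul_lt (hr : ∀ j, 0 < r j)
    (hw : UpperSemicontinuousOn w (Icc a b)) {x : Fin n → ℝ} {t c : ℝ} (ht : t ∈ Icc a b)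
    (h : gap r x t * w t < c) :
    ∀ᶠ p : (Fin n → ℝ) × ℝ in 𝓝 (x, t), p.2 ∈ Icc a b → gap r p.1 p.2 * w p.2 < c := by
  -- A constant `d` slightly above `w t` dominates `w` near `t`, leaving only the continuous factor
  -- to control.
  have hc : ∀ᶠ d in 𝓝[>] (w t), gap r x t * d < c :=
    (((continuous_const.mul continuous_id).tendsto (w t)).eventually_lt_const h).filter_mono
      nhdsWithin_le_nhds
  obtain ⟨d, hd, hwd⟩ := (hc.and self_mem_nhdsWithin).exists
  have h1 : ∀ᶠ p : (Fin n → ℝ) × ℝ in 𝓝 (x, t), gap r p.1 p.2 * d < c :=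
    (((continuous_gap hr).mul continuous_const).tendsto (x, t)).eventually_lt_const hd
  have h2 : ∀ᶠ p : (Fin n → ℝ) × ℝ in 𝓝 (x, t), p.2 ∈ Icc a b → w p.2 < d :=
    (continuous_snd.tendsto (x, t)).eventually (eventually_nhdsWithin_iff.1 (hw t ht d hwd))
  filter_upwards [h1, h2] with p hp1 hp2 hp
  exact (mul_le_mul_of_nonneg_left (hp2 hp).le (gap_nonneg _ _ _)).trans_lt hp1

lemma exists_gap_mul_eq (hr : ∀ j, 0 < r j) (hab : a < b) (hw0 : ∀ t ∈ Icc a b, 0 ≤ w t)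
    (hw : UpperSemicontinuousOn w (Icc a b)) (x : Fin n → ℝ) :
    ∃ t ∈ Icc a b, gap r x t * w t = weightedNorm a b w (gap r x) := by
  have hu : UpperSemicontinuousOn (fun t => gap r x t * w t) (Icc a b) := by
    intro t ht c hc
    have h := eventually_gap_mul_lt hr hw ht hc
    have h2 := (by fun_prop : Continuous fun s : ℝ => (x, s)).tendsto t |>.eventually h
    exact eventually_nhdsWithin_iff.2 h2
  obtain ⟨t, ht, hmax⟩ := hu.exists_isMaxOn (nonempty_Icc.2 hab.le) isCompact_Icc
  refine ⟨t, ht, le_antisymm (gap_mul_le hr hw0 hw x ht) (weightedNorm_le hab fun s hs => ?_)⟩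
  rw [abs_of_nonneg (gap_nonneg r x s)]
  exact hmax hs

lemma isCompact_closedSimplex : IsCompact (closedSimplex n a b) := by
  have h : IsCompact (univ.pi fun _ : Fin n => Icc a b) := isCompact_univ_pi fun _ => isCompact_Icc
  have he : closedSimplex n a b = {x | Monotone x} ∩ univ.pi fun _ : Fin n => Icc a b := by
    ext x
    simp only [closedSimplex, mem_ofPred_eq, mem_inter_iff, Set.mem_pi, mem_univ, true_imp_iff]
  rw [he]
  exact h.inter_left isClosed_monotone

lemma exists_minimal_nodes (hr : ∀ j, 0 < r j) (hab : a < b) (hw0 : ∀ t ∈ Icc a b, 0 ≤ w t)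
    (hw : UpperSemicontinuousOn w (Icc a b)) :
    ∃ x ∈ closedSimplex n a b, ∀ y ∈ closedSimplex n a b,
      weightedNorm a b w (gap r x) ≤ weightedNorm a b w (gap r y) := by
  -- The norm is a supremum over `t` of functions continuous in the nodes.
  have hl : LowerSemicontinuousOn (fun x => weightedNorm a b w (gap r x))
      (closedSimplex n a b) := by
    intro x _ c hc
    obtain ⟨t, ht, he⟩ := exists_gap_mul_eq hr hab hw0 hw x
    have : ∀ᶠ y in 𝓝 x, c < gap r y t * w t :=
      (((continuous_gap_left hr t).mul continuous_const).tendsto x).eventually_const_lt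
        (by simpa [he] using hc)
    filter_upwards [this.filter_mono nhdsWithin_le_nhds] with y hy
    exact hy.trans_le (gap_mul_le hr hw0 hw y ht)
  have hne : (closedSimplex n a b).Nonempty :=
    ⟨fun _ => a, fun _ _ _ => le_rfl, fun _ => ⟨le_rfl, hab.le⟩⟩
  obtain ⟨x, hx, hmin⟩ := hl.exists_isMinOn hne isCompact_closedSimplex
  exact ⟨x, hx, fun y hy => hmin hy⟩

/-- A weight that is positive at `n + 1` points is not annihilated by `n` nodes. -/
lemma weightedNorm_gap_pos (hr : ∀ j, 0 < r j) (hw0 : ∀ t ∈ Icc a b, 0 ≤ w t)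
    (hw : UpperSemicontinuousOn w (Icc a b)) {T : Finset ℝ} (hT : n < T.card)
    (hTw : ∀ t ∈ T, t ∈ Icc a b ∧ 0 < w t) (x : Fin n → ℝ) :
    0 < weightedNorm a b w (gap r x) := by
  obtain ⟨t, htT, ht⟩ : ∃ t ∈ T, t ∉ Finset.univ.image x :=
    Finset.exists_mem_notMem_of_card_lt_card
      ((Finset.card_image_le.trans (by simp)).trans_lt hT)
  have h1 : ∀ j, t ≠ x j := fun j e => ht (by simp [e])
  exact (mul_pos (gap_pos h1) (hTw t htT).2).trans_le (gap_mul_le hr hw0 hw x (hTw t htT).1)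

/-- Projecting complex zeros to `[a,b]` does not increase the modulus on `[a,b]`. -/
lemma abs_sub_projIcc_le (hab : a ≤ b) {t : ℝ} (ht : t ∈ Icc a b) (x y : ℝ) :
    |t - projIcc a b hab x| ≤ ‖(t : ℂ) - ((x : ℂ) + Complex.I * (y : ℂ))‖ := by
  have h1 : |t - projIcc a b hab x| ≤ |t - x| := by
    rw [coe_projIcc]
    obtain ⟨h1, h2⟩ := ht
    rcases le_total x a with h | h
    · rw [min_eq_right (h.trans hab), max_eq_left h, abs_of_nonneg (by linarith),
        abs_of_nonneg (by linarith)]; linarith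
    rcases le_total x b with h' | h'
    · rw [min_eq_right h', max_eq_right h]
    · rw [min_eq_left h', max_eq_right hab, abs_of_nonpos (by linarith),
        abs_of_nonpos (by linarith)]; linarith
  refine h1.trans ?_
  simpa using Complex.abs_re_le_norm ((t : ℂ) - ((x : ℂ) + Complex.I * (y : ℂ)))

/-- Equality case of `abs_sub_projIcc_le`: moving a zero by projection strictly shortens its
distance to every point of `[a,b]`. -/
lemma eq_of_norm_le_abs_sub_projIcc (hab : a ≤ b) {t : ℝ} (ht : t ∈ Icc a b) {x y : ℝ}
    (h : ‖(t : ℂ) - ((x : ℂ) + Complex.I * (y : ℂ))‖ ≤ |t - projIcc a b hab x|) :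
    x ∈ Icc a b ∧ y = 0 := by
  have hsq : (t - x) ^ 2 + y ^ 2 ≤ (t - projIcc a b hab x) ^ 2 := by
    have := pow_le_pow_left₀ (norm_nonneg _) h 2
    rw [sq_abs, ← Complex.normSq_eq_norm_sq, Complex.normSq_apply] at this
    simp only [Complex.sub_re, Complex.ofReal_re, Complex.add_re, Complex.mul_re, Complex.I_re,
      Complex.I_im, Complex.ofReal_im, Complex.sub_im, Complex.add_im, Complex.mul_im] at this
    nlinarith
  obtain ⟨h1, h2⟩ := ht
  rw [coe_projIcc] at hsq
  rcases lt_or_ge x a with h | h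
  · rw [min_eq_right (h.le.trans hab), max_eq_left h.le] at hsq
    nlinarith [sq_nonneg y]
  rcases le_or_gt x b with h' | h'
  · rw [min_eq_right h', max_eq_right h] at hsq
    exact ⟨⟨h, h'⟩, by nlinarith [sq_nonneg y]⟩
  · rw [min_eq_left h'.le, max_eq_right hab] at hsq
    nlinarith [sq_nonneg y]

lemma projIcc_mem_closedSimplex (hab : a ≤ b) {x : Fin n → ℝ} (hx : Monotone x) :
    (fun j => (projIcc a b hab (x j) : ℝ)) ∈ closedSimplex n a b :=
  ⟨fun _ _ h => monotone_projIcc hab (hx h), fun j => (projIcc a b hab (x j)).2⟩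

lemma gap_projIcc_le_complexGap (hr : ∀ j, 0 < r j) (hab : a ≤ b) (x y : Fin n → ℝ) {t : ℝ}
    (ht : t ∈ Icc a b) :
    gap r (fun j => (projIcc a b hab (x j) : ℝ)) t ≤ complexGap r x y t :=
  Finset.prod_le_prod (fun _ _ => Real.rpow_nonneg (abs_nonneg _) _) fun j _ =>
    Real.rpow_le_rpow (abs_nonneg _) (abs_sub_projIcc_le hab ht _ _) (hr j).le

lemma complexGap_nonneg (r x y : Fin n → ℝ) (t : ℝ) : 0 ≤ complexGap r x y t :=
  Finset.prod_nonneg fun _ _ => Real.rpow_nonneg (norm_nonneg _) _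

lemma continuous_complexGap (hr : ∀ j, 0 < r j) (x y : Fin n → ℝ) :
    Continuous (complexGap r x y) := by
  unfold complexGap
  refine continuous_finsetProd _ fun j _ => ?_
  exact Continuous.rpow_const (by fun_prop) fun _ => Or.inr (hr j).le

lemma complexGap_zero (r x : Fin n → ℝ) : complexGap r x 0 = gap r x := by
  ext t
  refine Finset.prod_congr rfl fun j _ => ?_
  have : (t : ℂ) - ((x j : ℂ) + Complex.I * (((0 : Fin n → ℝ) j : ℝ) : ℂ))
      = ((t - x j : ℝ) : ℂ) := by
    simp
  rw [this, Complex.norm_real, Real.norm_eq_abs]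

lemma weightedNorm_gap_projIcc_le (hr : ∀ j, 0 < r j) (hab : a < b)
    (hw0 : ∀ t ∈ Icc a b, 0 ≤ w t) (hw : UpperSemicontinuousOn w (Icc a b)) (x y : Fin n → ℝ) :
    weightedNorm a b w (gap r (fun j => (projIcc a b hab.le (x j) : ℝ))) ≤
      weightedNorm a b w (complexGap r x y) := by
  refine weightedNorm_mono hab (continuous_complexGap hr x y).continuousOn hw0 hw fun t ht => ?_
  rw [abs_of_nonneg (gap_nonneg _ _ _), abs_of_nonneg (complexGap_nonneg _ _ _ _)]
  exact gap_projIcc_le_complexGap hr hab.le x y ht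

/-- Besides giving the unrestricted problem, the case `z = 0` lets perturbed nodes leave `[a,b]`, so
perturbation arguments need no boundary cases. -/
lemma weightedNorm_gap_le_complexGap (hr : ∀ j, 0 < r j) (hab : a < b)
    (hw0 : ∀ t ∈ Icc a b, 0 ≤ w t) (hw : UpperSemicontinuousOn w (Icc a b)) {x : Fin n → ℝ}
    (hmin : ∀ y ∈ closedSimplex n a b,
      weightedNorm a b w (gap r x) ≤ weightedNorm a b w (gap r y))
    {y : Fin n → ℝ} (hy : Monotone y) (z : Fin n → ℝ) :
    weightedNorm a b w (gap r x) ≤ weightedNorm a b w (complexGap r y z) :=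
  (hmin _ (projIcc_mem_closedSimplex hab.le hy)).trans
    (weightedNorm_gap_projIcc_le hr hab hw0 hw y z)

/-- An unrestricted generalized polynomial that is no larger in norm than an extremal restricted
one has all its zeros in `[a,b]`. -/
lemma real_zeros_of_weightedNorm_le (hr : ∀ j, 0 < r j) (hab : a < b)
    (hw0 : ∀ t ∈ Icc a b, 0 ≤ w t) (hw : UpperSemicontinuousOn w (Icc a b)) {x y : Fin n → ℝ}
    (hpos : 0 < weightedNorm a b w (gap r (fun j => (projIcc a b hab.le (x j) : ℝ))))
    (h : weightedNorm a b w (complexGap r x y) ≤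
      weightedNorm a b w (gap r (fun j => (projIcc a b hab.le (x j) : ℝ)))) :
    (∀ j, x j ∈ Icc a b) ∧ y = 0 := by
  -- At a maximum point of the projected polynomial all its factors are positive, so one strictly
  -- shortened factor would already make the product strictly smaller.
  obtain ⟨t, ht, he⟩ := exists_gap_mul_eq hr hab hw0 hw
    (fun j => (projIcc a b hab.le (x j) : ℝ))
  have hwt : 0 < w t := pos_of_mul_pos_right (he ▸ hpos) (gap_nonneg _ _ _)
  have hg : 0 < gap r (fun j => (projIcc a b hab.le (x j) : ℝ)) t :=
    pos_of_mul_pos_left (he ▸ hpos) hwt.le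
  have hle : complexGap r x y t ≤ gap r (fun j => (projIcc a b hab.le (x j) : ℝ)) t := by
    have h1 := mul_le_weightedNorm (continuous_complexGap hr x y).continuousOn hw0 hw ht
    rw [abs_of_nonneg (complexGap_nonneg _ _ _ _)] at h1
    exact le_of_mul_le_mul_right ((h1.trans h).trans he.ge) hwt
  have key : ∀ j, x j ∈ Icc a b ∧ y j = 0 := by
    intro j
    refine eq_of_norm_le_abs_sub_projIcc hab.le ht ?_
    by_contra! hlt
    refine absurd hle (not_le.2 ?_)
    refine Finset.prod_lt_prod (fun i _ => ?_) (fun i _ => ?_) ⟨j, Finset.mem_univ _, ?_⟩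
    · exact Real.rpow_pos_of_pos (abs_pos.2 (sub_ne_zero.2 (ne_node_of_gap_pos hr hg i))) _
    · exact Real.rpow_le_rpow (abs_nonneg _) (abs_sub_projIcc_le hab.le ht _ _) (hr i).le
    · exact Real.rpow_lt_rpow (abs_nonneg _) hlt (hr j)
  exact ⟨fun j => (key j).1, funext fun j => (key j).2⟩

end Basics

/-! ### First-order perturbation of nodes and necessary conditions at a minimum -/

section Perturbation

variable {n : ℕ} {r : Fin n → ℝ} {a b : ℝ} {w : ℝ → ℝ}

/-- First order comparison of two generalized polynomials whose nodes are moved by `h`, when no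
node crosses `t`. -/
lemma gap_lt_gap_of_sum_nonneg (hr : ∀ j, 0 < r j) {x y : Fin n → ℝ} {t : ℝ}
    (hxy : ∀ j, 0 < (t - y j) / (t - x j)) (hne : x ≠ y)
    (hsum : 0 ≤ ∑ j, r j * (y j - x j) / (t - x j)) : gap r y t < gap r x t := by
  have hx : ∀ j, t ≠ x j := fun j e => by
    have := hxy j
    simp [e] at this
  have hy : ∀ j, t ≠ y j := fun j e => by
    have := hxy j
    simp [e] at this
  obtain ⟨i, hi⟩ : ∃ i, x i ≠ y i := Function.ne_iff.1 hne
  have hx' : ∀ j, t - x j ≠ 0 := fun j => sub_ne_zero.2 (hx j)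
  have hy' : ∀ j, t - y j ≠ 0 := fun j => sub_ne_zero.2 (hy j)
  have hlog : ∀ j, r j * Real.log (t - y j) - r j * Real.log (t - x j) =
      r j * Real.log ((t - y j) / (t - x j)) := fun j => by
    rw [Real.log_div (hy' j) (hx' j)]; ring
  have heq : ∀ j, -(r j * (y j - x j) / (t - x j)) =
      r j * ((t - y j) / (t - x j) - 1) := fun j => by
    have := hx' j
    field_simp
    ring
  -- `log u < u - 1` for `u ≠ 1` makes the comparison strict, even when the first-order sum is zero.
  have hlt : ∑ j, r j * Real.log ((t - y j) / (t - x j)) <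
      ∑ j, r j * ((t - y j) / (t - x j) - 1) := by
    refine Finset.sum_lt_sum (fun j _ => ?_) ⟨i, Finset.mem_univ _, ?_⟩
    · exact mul_le_mul_of_nonneg_left (Real.log_le_sub_one_of_pos (hxy j)) (hr j).le
    · refine mul_lt_mul_of_pos_left (Real.log_lt_sub_one_of_pos (hxy i) fun h => hi ?_) (hr i)
      rw [div_eq_one_iff_eq (hx' i)] at h
      linarith
  rw [← Real.log_lt_log_iff (gap_pos hy) (gap_pos hx), log_gap hy, log_gap hx, ← sub_neg,
    ← Finset.sum_sub_distrib]
  simp only [hlog]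
  refine hlt.trans_le ?_
  simp only [← heq, Finset.sum_neg_distrib]
  linarith

/-- Moving the nodes in a direction which does not increase the modulus near the maximum points
decreases the norm. -/
lemma eventually_weightedNorm_lt (hr : ∀ j, 0 < r j) (hab : a < b)
    (hw0 : ∀ t ∈ Icc a b, 0 ≤ w t) (hw : UpperSemicontinuousOn w (Icc a b)) {x h : Fin n → ℝ}
    (hpos : 0 < weightedNorm a b w (gap r x)) (hne : h ≠ 0)
    (hdir : ∀ t ∈ Icc a b, gap r x t * w t = weightedNorm a b w (gap r x) →
      ∀ᶠ s in 𝓝 t, 0 ≤ ∑ j, r j * h j / (s - x j)) :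
    ∀ᶠ δ in 𝓝[>] (0 : ℝ),
      weightedNorm a b w (gap r (x + δ • h)) < weightedNorm a b w (gap r x) := by
  set M := weightedNorm a b w (gap r x) with hM
  have hcont : Continuous fun z : ℝ × ℝ => (x + z.1 • h, z.2) := by fun_prop
  -- The estimate is joint in the step and the point, so compactness yields one step size valid on
  -- all of `[a,b]`.
  have key : ∀ t ∈ Icc a b, ∀ᶠ z : ℝ × ℝ in 𝓝 (0, t),
      z.2 ∈ Icc a b → 0 < z.1 → gap r (x + z.1 • h) z.2 * w z.2 < M := by
    intro t ht
    rcases (gap_mul_le hr hw0 hw x ht).lt_or_eq with hlt | heq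
    · have h1 := eventually_gap_mul_lt hr hw ht hlt
      have h2 := (hcont.tendsto (0, t)).eventually
        (p := fun p => p.2 ∈ Icc a b → gap r p.1 p.2 * w p.2 < M) (by simpa using h1)
      filter_upwards [h2] with z hz hz2 _ using hz hz2
    · have hg : 0 < gap r x t := by
        refine (gap_nonneg r x t).lt_of_ne fun h0 => ?_
        rw [← h0, zero_mul] at heq
        exact hpos.ne heq
      have hx := ne_node_of_gap_pos hr hg
      have h1 : ∀ᶠ z : ℝ × ℝ in 𝓝 (0, t), ∀ j, 0 < (z.2 - (x + z.1 • h) j) / (z.2 - x j) := by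
        refine eventually_all.2 fun j => ?_
        have hc : ContinuousAt (fun z : ℝ × ℝ => (z.2 - (x + z.1 • h) j) / (z.2 - x j))
            (0, t) := by
          refine ContinuousAt.div ?_ ?_ (sub_ne_zero.2 (hx j))
          · simp only [Pi.add_apply, Pi.smul_apply, smul_eq_mul]
            fun_prop
          · fun_prop
        refine hc.eventually_const_lt ?_
        simp [div_self (sub_ne_zero.2 (hx j))]
      have h2 : ∀ᶠ z : ℝ × ℝ in 𝓝 (0, t), 0 ≤ ∑ j, r j * h j / (z.2 - x j) :=
        (continuous_snd.tendsto ((0, t) : ℝ × ℝ)).eventually (hdir t ht heq)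
      filter_upwards [h1, h2] with z hz1 hz2 hz hδ
      have hlt : gap r (x + z.1 • h) z.2 < gap r x z.2 := by
        refine gap_lt_gap_of_sum_nonneg hr hz1 (fun e => hne ?_) ?_
        · have : z.1 • h = 0 := by simpa using e.symm
          exact (smul_eq_zero.1 this).resolve_left hδ.ne'
        · have : ∑ j, r j * ((x + z.1 • h) j - x j) / (z.2 - x j) =
              z.1 * ∑ j, r j * h j / (z.2 - x j) := by
            rw [Finset.mul_sum]
            refine Finset.sum_congr rfl fun j _ => ?_
            simp only [Pi.add_apply, Pi.smul_apply, smul_eq_mul]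
            ring
          rw [this]
          exact mul_nonneg hδ.le hz2
      rcases (hw0 _ hz).eq_or_lt with h0 | h0
      · rw [← h0, mul_zero]; exact hpos
      · exact (mul_lt_mul_of_pos_right hlt h0).trans_le (gap_mul_le hr hw0 hw x hz)
  have hall := isCompact_Icc.eventually_forall_of_forall_eventually
    (P := fun δ t => t ∈ Icc a b → 0 < δ → gap r (x + δ • h) t * w t < M) key
  filter_upwards [hall.filter_mono nhdsWithin_le_nhds, self_mem_nhdsWithin] with δ hδ hδ0
  obtain ⟨t, ht, he⟩ := exists_gap_mul_eq hr hab hw0 hw (x + δ • h)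
  exact he ▸ hδ t ht ht hδ0

/-- Strict inequalities between nodes survive small steps; only coinciding nodes constrain the
direction. -/
lemma eventually_monotone_add_smul {x h : Fin n → ℝ}
    (hxh : ∀ i j, i ≤ j → x i < x j ∨ x i = x j ∧ h i ≤ h j) :
    ∀ᶠ δ in 𝓝[>] (0 : ℝ), Monotone (x + δ • h) := by
  have : ∀ᶠ δ in 𝓝[>] (0 : ℝ), ∀ i j, i ≤ j → (x + δ • h) i ≤ (x + δ • h) j := by
    refine eventually_all.2 fun i => eventually_all.2 fun j => ?_
    by_cases hij : i ≤ j
    · rcases hxh i j hij with hlt | ⟨he, hle⟩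
      · have : ∀ᶠ δ in 𝓝 (0 : ℝ), (x + δ • h) i < (x + δ • h) j := by
          have h1 : Continuous fun δ : ℝ => x i + δ * h i := by fun_prop
          have h2 : Continuous fun δ : ℝ => x j + δ * h j := by fun_prop
          exact (h1.tendsto 0).eventually_lt (h2.tendsto 0) (by simpa using hlt)
        filter_upwards [this.filter_mono nhdsWithin_le_nhds] with δ hδ _ using hδ.le
      · filter_upwards [self_mem_nhdsWithin] with δ hδ _
        simp only [Pi.add_apply, Pi.smul_apply, smul_eq_mul, he]
        exact add_le_add_right (mul_le_mul_of_nonneg_left hle (le_of_lt hδ)) _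
    · exact Eventually.of_forall fun δ hle => absurd hle hij
  exact this.mono fun δ hδ i j hij => hδ i j hij

/-- At a minimal node system no admissible direction can be a descent direction. -/
lemma not_descent_direction (hr : ∀ j, 0 < r j) (hab : a < b)
    (hw0 : ∀ t ∈ Icc a b, 0 ≤ w t) (hw : UpperSemicontinuousOn w (Icc a b)) {x h : Fin n → ℝ}
    (hpos : 0 < weightedNorm a b w (gap r x))
    (hmin : ∀ y ∈ closedSimplex n a b,
      weightedNorm a b w (gap r x) ≤ weightedNorm a b w (gap r y))
    (hne : h ≠ 0) (hxh : ∀ i j, i ≤ j → x i < x j ∨ x i = x j ∧ h i ≤ h j)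
    (hdir : ∀ t ∈ Icc a b, gap r x t * w t = weightedNorm a b w (gap r x) →
      ∀ᶠ s in 𝓝 t, 0 ≤ ∑ j, r j * h j / (s - x j)) : False := by
  obtain ⟨δ, h1, h2⟩ := ((eventually_weightedNorm_lt hr hab hw0 hw hpos hne hdir).and
    (eventually_monotone_add_smul hxh)).exists
  have := weightedNorm_gap_le_complexGap hr hab hw0 hw hmin h2 0
  rw [complexGap_zero] at this
  exact absurd h1 (not_lt.2 this)

/-- A maximum point lies between any two nodes that can be moved apart. -/
lemma exists_max_between (hr : ∀ j, 0 < r j) (hab : a < b)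
    (hw0 : ∀ t ∈ Icc a b, 0 ≤ w t) (hw : UpperSemicontinuousOn w (Icc a b)) {x : Fin n → ℝ}
    (hpos : 0 < weightedNorm a b w (gap r x)) (hx : Monotone x)
    (hmin : ∀ y ∈ closedSimplex n a b,
      weightedNorm a b w (gap r x) ≤ weightedNorm a b w (gap r y))
    {p q : Fin n} (hpq : p < q) (hp : ∀ i < p, x i < x p) (hq : ∀ i, q < i → x q < x i) :
    ∃ t ∈ Icc a b, x p < t ∧ t < x q ∧ gap r x t * w t = weightedNorm a b w (gap r x) := by
  by_contra! hno
  have hpr := hr p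
  have hqr := hr q
  -- The factors `1 / r` cancel the exponents: the first-order sum becomes `1 / (s - x q) - 1 / (s -
  -- x p)`, which is nonnegative off `[x p, x q]`, and identically zero when the two nodes coincide.
  set h : Fin n → ℝ := fun i => if i = p then -(1 / r p) else if i = q then 1 / r q else 0
    with hh
  have hhp : h p = -(1 / r p) := by simp [hh]
  have hhq : h q = 1 / r q := by simp [hh, hpq.ne']
  have hho : ∀ i, i ≠ p → i ≠ q → h i = 0 := fun i h1 h2 => by simp [hh, h1, h2]
  have hppos : 0 < 1 / r p := by positivity
  have hqpos : 0 < 1 / r q := by positivity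
  have hsum : ∀ s, ∑ j, r j * h j / (s - x j) = 1 / (s - x q) - 1 / (s - x p) := fun s => by
    rw [Finset.sum_eq_add p q hpq.ne (fun i _ hi => by rw [hho i hi.1 hi.2]; simp)
      (by simp) (by simp), hhp, hhq, mul_one_div_cancel hqr.ne', mul_neg,
      mul_one_div_cancel hpr.ne']
    ring
  refine not_descent_direction hr hab hw0 hw hpos hmin (h := h) ?_ ?_ ?_
  · exact fun e => by rw [e] at hhq; exact hqpos.ne hhq
  · intro i j hij
    rcases (hx hij).lt_or_eq with hlt | heq
    · exact Or.inl hlt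
    refine Or.inr ⟨heq, ?_⟩
    rcases hij.eq_or_lt with rfl | hlt
    · rfl
    have hjp : j ≠ p := fun e => by
      subst e; exact (hp i hlt).ne heq
    have hiq : i ≠ q := fun e => by
      subst e; exact (hq j hlt).ne heq
    by_cases hip : i = p
    · rw [hip, hhp]
      by_cases hjq : j = q
      · rw [hjq, hhq]; linarith
      · rw [hho j hjp hjq]; linarith
    · rw [hho i hip hiq]
      by_cases hjq : j = q
      · rw [hjq, hhq]; linarith
      · rw [hho j hjp hjq]
  · intro t ht he
    have hg : 0 < gap r x t := by
      refine (gap_nonneg r x t).lt_of_ne fun h0 => ?_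
      rw [← h0, zero_mul] at he
      exact hpos.ne he
    have hxt := ne_node_of_gap_pos hr hg
    have hle : x p ≤ x q := hx hpq.le
    have hcase : t < x p ∨ x q < t := by
      by_contra! hc
      exact hno t ht (lt_of_le_of_ne hc.1 (hxt p).symm) (lt_of_le_of_ne hc.2 (hxt q)) he
    simp only [hsum, sub_nonneg]
    rcases hcase with hc | hc
    · filter_upwards [Iio_mem_nhds hc] with s hs
      have hs' : s < x p := hs
      exact one_div_le_one_div_of_neg_of_le (by linarith) (by linarith)
    · filter_upwards [Ioi_mem_nhds hc] with s hs
      have hs' : x q < s := hs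
      exact one_div_le_one_div_of_le (by linarith) (by linarith)

/-- Splitting the first and last node of a block of equal nodes would require a maximum point
strictly between two equal numbers. -/
lemma strictMono_of_minimal (hr : ∀ j, 0 < r j) (hab : a < b)
    (hw0 : ∀ t ∈ Icc a b, 0 ≤ w t) (hw : UpperSemicontinuousOn w (Icc a b)) {x : Fin n → ℝ}
    (hpos : 0 < weightedNorm a b w (gap r x)) (hx : Monotone x)
    (hmin : ∀ y ∈ closedSimplex n a b,
      weightedNorm a b w (gap r x) ≤ weightedNorm a b w (gap r y)) : StrictMono x := by
  refine hx.strictMono_of_injective fun i j hij => ?_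
  by_contra hne
  set S : Finset (Fin n) := Finset.univ.filter fun k => x k = x i with hS
  have hiS : i ∈ S := by simp [hS]
  have hjS : j ∈ S := by simp [hS, hij]
  have hSne : S.Nonempty := ⟨i, hiS⟩
  have hmem : ∀ k, k ∈ S ↔ x k = x i := fun k => by simp [hS]
  have hp := (hmem _).1 (S.min'_mem hSne)
  have hq := (hmem _).1 (S.max'_mem hSne)
  obtain ⟨t, -, h1, h2, -⟩ := exists_max_between hr hab hw0 hw hpos hx hmin
    (S.min'_lt_max' hiS hjS hne)
    (fun k hk => lt_of_le_of_ne (hx hk.le) fun e =>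
      absurd (S.min'_le k ((hmem k).2 (e.trans hp))) (not_le.2 hk))
    (fun k hk => lt_of_le_of_ne (hx hk.le) fun e =>
      absurd (S.le_max' k ((hmem k).2 (e.symm.trans hq))) (not_le.2 hk))
  rw [hp] at h1
  rw [hq] at h2
  exact lt_asymm h1 h2

/-- Otherwise every maximum point lies on the `σ` side of `x p`, and moving this node alone towards
them lowers the norm. -/
lemma exists_max_beside (hr : ∀ j, 0 < r j) (hab : a < b)
    (hw0 : ∀ t ∈ Icc a b, 0 ≤ w t) (hw : UpperSemicontinuousOn w (Icc a b)) {x : Fin n → ℝ}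
    (hpos : 0 < weightedNorm a b w (gap r x)) (hx : StrictMono x)
    (hmin : ∀ y ∈ closedSimplex n a b,
      weightedNorm a b w (gap r x) ≤ weightedNorm a b w (gap r y)) (p : Fin n)
    {σ : ℝ} (hσ : σ ≠ 0) :
    ∃ t ∈ Icc a b, σ * (t - x p) < 0 ∧ gap r x t * w t = weightedNorm a b w (gap r x) := by
  by_contra! hno
  have hpr := hr p
  have hsum : ∀ s, ∑ j, r j * (Pi.single p σ : Fin n → ℝ) j / (s - x j) =
      r p * σ / (s - x p) := fun s => by
    rw [Finset.sum_eq_single p (fun i _ hi => by simp [hi]) (by simp)]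
    simp
  refine not_descent_direction hr hab hw0 hw hpos hmin (h := Pi.single p σ)
    (by simpa using hσ) ?_ ?_
  · intro i j hij
    rcases hij.eq_or_lt with rfl | hlt
    · exact Or.inr ⟨rfl, le_rfl⟩
    · exact Or.inl (hx hlt)
  · intro t ht he
    have hg : 0 < gap r x t := by
      refine (gap_nonneg r x t).lt_of_ne fun h0 => ?_
      rw [← h0, zero_mul] at he
      exact hpos.ne he
    have hxt := ne_node_of_gap_pos hr hg p
    have hlt : 0 < σ * (t - x p) := by
      refine lt_of_le_of_ne (not_lt.1 fun hc => hno t ht hc he) ?_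
      exact (mul_ne_zero hσ (sub_ne_zero.2 hxt)).symm
    have hev : ∀ᶠ s in 𝓝 t, 0 < σ * (s - x p) :=
      ((by fun_prop : Continuous fun s => σ * (s - x p)).tendsto t).eventually_const_lt hlt
    filter_upwards [hev] with s hs
    rw [hsum, mul_div_assoc]
    refine mul_nonneg hpr.le ?_
    have hs0 : s - x p ≠ 0 := right_ne_zero_of_mul hs.ne'
    have : σ / (s - x p) = σ * (s - x p) / (s - x p) ^ 2 := by
      field_simp
    rw [this]
    positivity

/-- A minimal node system has the interlacing attainment property. -/
lemma exists_interlaces_of_minimal (hn : 1 ≤ n) (hr : ∀ j, 0 < r j) (hab : a < b)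
    (hw0 : ∀ t ∈ Icc a b, 0 ≤ w t) (hw : UpperSemicontinuousOn w (Icc a b)) {x : Fin n → ℝ}
    (hpos : 0 < weightedNorm a b w (gap r x)) (hx : Monotone x)
    (hmin : ∀ y ∈ closedSimplex n a b,
      weightedNorm a b w (gap r x) ≤ weightedNorm a b w (gap r y)) :
    ∃ t : Fin (n + 1) → ℝ, Interlaces a b x t ∧ AttainsNormAt a b w (gap r x) t := by
  have hs := strictMono_of_minimal hr hab hw0 hw hpos hx hmin
  have key : ∀ k : Fin (n + 1), ∃ t ∈ Icc a b,
      gap r x t * w t = weightedNorm a b w (gap r x) ∧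
      (∀ j : Fin n, j.castSucc = k → t < x j) ∧ (∀ j : Fin n, j.succ = k → x j < t) := by
    intro k
    rcases Nat.eq_zero_or_pos k.1 with h0 | h0
    · obtain ⟨t, ht, h1, h2⟩ := exists_max_beside hr hab hw0 hw hpos hs hmin ⟨0, hn⟩
        (σ := 1) one_ne_zero
      refine ⟨t, ht, h2, fun j hj => ?_, fun j hj => ?_⟩
      · have : j = ⟨0, hn⟩ := Fin.ext (by simpa [h0] using congrArg Fin.val hj)
        rw [this]; linarith
      · have := congrArg Fin.val hj
        simp [h0] at this
    rcases Nat.lt_or_ge k.1 n with h1 | h1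
    · obtain ⟨t, ht, h2, h3, h4⟩ := exists_max_between hr hab hw0 hw hpos hx hmin
        (p := ⟨k.1 - 1, by omega⟩) (q := ⟨k.1, h1⟩) (Fin.mk_lt_mk.2 (by omega))
        (fun i hi => hs hi) (fun i hi => hs hi)
      refine ⟨t, ht, h4, fun j hj => ?_, fun j hj => ?_⟩
      · have : j = ⟨k.1, h1⟩ := Fin.ext (by simpa using congrArg Fin.val hj)
        rwa [this]
      · have : j = ⟨k.1 - 1, by omega⟩ := Fin.ext (by
          have := congrArg Fin.val hj
          simp at this ⊢; omega)
        rwa [this]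
    · obtain ⟨t, ht, h2, h3⟩ := exists_max_beside hr hab hw0 hw hpos hs hmin ⟨n - 1, by omega⟩
        (σ := -1) (by norm_num)
      refine ⟨t, ht, h3, fun j hj => ?_, fun j hj => ?_⟩
      · have := congrArg Fin.val hj
        have := j.2
        simp at *
        omega
      · have : j = ⟨n - 1, by omega⟩ := Fin.ext (by
          have := congrArg Fin.val hj
          have := k.2
          simp at *; omega)
        rw [this]; linarith
  choose t ht hmax hl hu using key
  exact ⟨t, ⟨ht, fun j => ⟨hl _ j rfl, hu _ j rfl⟩⟩, hmax⟩

end Perturbation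

/-! ### Comparison on interlacing systems and uniqueness -/

section Uniqueness

variable {n : ℕ} {r : Fin n → ℝ} {a b : ℝ} {w : ℝ → ℝ}

lemma Interlaces.strictMono {x : Fin n → ℝ} {t : Fin (n + 1) → ℝ} (h : Interlaces a b x t) :
    StrictMono t :=
  Fin.strictMono_iff_lt_succ.2 fun j => (h.2 j).1.trans (h.2 j).2

lemma Interlaces.ne {x : Fin n → ℝ} {t : Fin (n + 1) → ℝ} (h : Interlaces a b x t)
    (k : Fin (n + 1)) (j : Fin n) : t k ≠ x j := by
  rcases lt_or_ge j.castSucc k with hk | hk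
  · exact ((h.2 j).2.trans_le (h.strictMono.monotone (Fin.castSucc_lt_iff_succ_le.1 hk))).ne'
  · exact ((h.strictMono.monotone hk).trans_lt (h.2 j).1).ne

lemma Interlaces.div_pos {x y : Fin n → ℝ} {t : Fin (n + 1) → ℝ} (hx : Interlaces a b x t)
    (hy : Interlaces a b y t) (k : Fin (n + 1)) (j : Fin n) :
    0 < (t k - y j) / (t k - x j) := by
  rcases lt_or_ge j.castSucc k with hk | hk
  · have h1 := hx.strictMono.monotone (Fin.castSucc_lt_iff_succ_le.1 hk)
    exact _root_.div_pos (by linarith [(hy.2 j).2]) (by linarith [(hx.2 j).2])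
  · have h1 := hx.strictMono.monotone hk
    exact div_pos_of_neg_of_neg (by linarith [(hy.2 j).1]) (by linarith [(hx.2 j).1])

open Polynomial in
/-- A sum of simple fractions with poles `x` is not positive at all points of an interlacing
system, because a positive combination of its values vanishes. -/
lemma Interlaces.not_forall_sum_div_pos {x : Fin n → ℝ} {t : Fin (n + 1) → ℝ}
    (h : Interlaces a b x t) (c : Fin n → ℝ) : ¬ ∀ k, 0 < ∑ j, c j / (t k - x j) := by
  intro hpos
  set D : Fin (n + 1) → ℝ := fun k => ∏ l ∈ Finset.univ.erase k, (t k - t l) with hD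
  -- Interlacing puts `x j` and `t (k.succAbove j)` on the same side of `t k`, so the factors pair
  -- up with equal signs and `L k > 0`.
  set L : Fin (n + 1) → ℝ := fun k => (∏ j, (t k - x j)) / D k with hL
  have hDprod : ∀ k, D k = ∏ j : Fin n, (t k - t (k.succAbove j)) := fun k => by
    have : Finset.univ.erase k = Finset.univ.image k.succAbove := by
      rw [Fin.image_succAbove_univ]
      ext; simp
    rw [hD]
    simp only [this]
    rw [Finset.prod_image fun _ _ _ _ e => Fin.succAbove_right_injective e]
  have hLpos : ∀ k, 0 < L k := fun k => by
    simp only [hL, hDprod, ← Finset.prod_div_distrib]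
    refine Finset.prod_pos fun j _ => ?_
    rcases lt_or_ge j.castSucc k with hk | hk
    · rw [Fin.succAbove_of_castSucc_lt _ _ hk]
      have h1 := h.strictMono.monotone (Fin.castSucc_lt_iff_succ_le.1 hk)
      have h2 := h.2 j
      exact _root_.div_pos (by linarith) (by linarith)
    · rw [Fin.succAbove_of_le_castSucc _ _ hk]
      have h1 := h.strictMono.monotone hk
      have h2 := h.2 j
      exact div_pos_of_neg_of_neg (by linarith) (by linarith)
  -- Dividing by `t k - x j` deletes one factor of the numerator. The sum is then Lagrange's formula
  -- for the coefficient of `X ^ n` in a polynomial of degree `n - 1`.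
  have hzero : ∀ j, ∑ k, L k / (t k - x j) = 0 := fun j => by
    set P : ℝ[X] := Lagrange.nodal (Finset.univ.erase j) x with hP
    have hn : 0 < n := j.pos
    have hdeg : P.degree = ((n - 1 : ℕ) : WithBot ℕ) := by
      rw [hP, Lagrange.degree_nodal]; simp
    have hlt : P.degree < (n : WithBot ℕ) := by
      rw [hdeg]; exact_mod_cast Nat.sub_lt hn one_pos
    have hlt' : P.degree < ((Finset.univ : Finset (Fin (n + 1))).card : WithBot ℕ) := by
      refine hlt.trans ?_
      simp only [Finset.card_univ, Fintype.card_fin]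
      exact_mod_cast Nat.lt_succ_self n
    have hco := Lagrange.coeff_eq_sum (s := Finset.univ) (v := t)
      h.strictMono.injective.injOn hlt'
    have hc0 : P.coeff n = 0 := coeff_eq_zero_of_degree_lt hlt
    rw [Finset.card_univ, Fintype.card_fin, Nat.add_sub_cancel, hc0] at hco
    rw [hco]
    refine Finset.sum_congr rfl fun k _ => ?_
    rw [hP, Lagrange.eval_nodal]
    simp only [hL]
    rw [← Finset.mul_prod_erase _ _ (Finset.mem_univ j)]
    have := sub_ne_zero.2 (h.ne k j)
    field_simp
    rfl
  have hsum : 0 < ∑ k, L k * ∑ j, c j / (t k - x j) :=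
    Finset.sum_pos (fun k _ => mul_pos (hLpos k) (hpos k)) ⟨0, Finset.mem_univ _⟩
  have : ∑ k, L k * ∑ j, c j / (t k - x j) = ∑ j, c j * ∑ k, L k / (t k - x j) := by
    simp only [Finset.mul_sum]
    rw [Finset.sum_comm]
    exact Finset.sum_congr rfl fun j _ => Finset.sum_congr rfl fun k _ => by ring
  simp [this, hzero] at hsum

/-- If `y ≠ x`, the first-order sum for moving `y` to `x` must be negative at each `t k`, since
otherwise the value there would strictly drop; the Lagrange identity excludes this. -/
lemma Interlaces.eq_of_gap_le (hr : ∀ j, 0 < r j) {x y : Fin n → ℝ} {t : Fin (n + 1) → ℝ}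
    (hx : Interlaces a b x t) (hy : Interlaces a b y t)
    (h : ∀ k, gap r y (t k) ≤ gap r x (t k)) : y = x := by
  by_contra hne
  refine hy.not_forall_sum_div_pos (fun j => -(r j * (x j - y j))) fun k => ?_
  by_contra! hle
  refine absurd (gap_lt_gap_of_sum_nonneg hr (hy.div_pos hx k) hne ?_) (not_lt.2 (h k))
  simpa [neg_div] using hle

lemma strictMono_eq_id {m : ℕ} {f : Fin m → Fin m} (hf : StrictMono f) : f = id :=
  (hf.range_inj strictMono_id).1 <| by
    rw [range_id, (Finite.injective_iff_surjective.1 hf.injective).range_eq]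

/-- Comparison on an interlacing system; the node system `y` need not interlace. -/
lemma Interlaces.eq_of_gap_le_of_mem_closedSimplex (hn : 1 ≤ n) (hr : ∀ j, 0 < r j) (hab : a < b)
    {x y : Fin n → ℝ} {t : Fin (n + 1) → ℝ} (hx : x ∈ closedSimplex n a b)
    (hxt : Interlaces a b x t) (hy : y ∈ closedSimplex n a b)
    (h : ∀ k, gap r y (t k) ≤ gap r x (t k)) : y = x := by
  classical
  -- For this weight `gap r x` has norm 1, attained at every `t k`, and the hypothesis on `y` says
  -- that its norm is at most 1. It remains to see that `x` is the only minimizer for `v`.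
  set v : ℝ → ℝ := fun s => if s ∈ range t then (gap r x s)⁻¹ else 0 with hv
  have hvt : ∀ k, v (t k) = (gap r x (t k))⁻¹ := fun k => by simp [hv]
  have hgt : ∀ k, 0 < gap r x (t k) := fun k => gap_pos (hxt.ne k)
  have hv0 : ∀ s, 0 ≤ v s := fun s => by
    simp only [hv]
    split_ifs
    exacts [inv_nonneg.2 (gap_nonneg _ _ _), le_rfl]
  have hvu : UpperSemicontinuousOn v (Icc a b) := by
    intro s _ c hc
    have hfin : (range t \ {s}).Finite := (finite_range t).subset sdiff_subset
    have hev : ∀ᶠ u in 𝓝 s, u ∉ range t \ {s} :=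
      hfin.isClosed.isOpen_compl.mem_nhds (by simp)
    filter_upwards [hev.filter_mono nhdsWithin_le_nhds] with u hu
    by_cases hus : u = s
    · rwa [hus]
    · have : u ∉ range t := fun hut => hu ⟨hut, hus⟩
      have hvu : v u = 0 := by simp only [hv, if_neg this]
      exact hvu ▸ (hv0 s).trans_lt hc
  have hpos : ∀ z, 0 < weightedNorm a b v (gap r z) := fun z => by
    refine weightedNorm_gap_pos hr (fun s _ => hv0 s) hvu
      (T := Finset.univ.image t) ?_ ?_ z
    · rw [Finset.card_image_of_injective _ hxt.strictMono.injective]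
      simp
    · simp only [Finset.mem_image, Finset.mem_univ, true_and, forall_exists_index,
        forall_apply_eq_imp_iff]
      exact fun k => ⟨hxt.1 k, hvt k ▸ inv_pos.2 (hgt k)⟩
  have hle1 : ∀ z : Fin n → ℝ, (∀ k, gap r z (t k) ≤ gap r x (t k)) →
      weightedNorm a b v (gap r z) ≤ 1 := fun z hz => by
    refine weightedNorm_le hab fun s _ => ?_
    rw [abs_of_nonneg (gap_nonneg _ _ _)]
    by_cases hs : s ∈ range t
    · obtain ⟨k, rfl⟩ := hs
      rw [hvt, ← div_eq_mul_inv, div_le_one (hgt k)]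
      exact hz k
    · simp only [hv]
      rw [if_neg hs, mul_zero]
      exact zero_le_one
  have hmin_eq : ∀ z ∈ closedSimplex n a b, (∀ u ∈ closedSimplex n a b,
      weightedNorm a b v (gap r z) ≤ weightedNorm a b v (gap r u)) → z = x := by
    intro z hz hmin
    obtain ⟨s, hzs, hs⟩ := exists_interlaces_of_minimal hn hr hab (fun s _ => hv0 s) hvu
      (hpos z) hz.1 hmin
    -- Maximum points lie where `v` is nonzero; `n + 1` increasing ones must exhaust `t`, so `z`
    -- interlaces the same system as `x`.
    have hmem : ∀ k, ∃ l, t l = s k := fun k => by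
      by_contra hk
      have h0 : v (s k) = 0 := by
        simp only [hv]
        exact if_neg hk
      have := hs k
      rw [h0, mul_zero] at this
      exact (hpos z).ne this
    choose f hf using hmem
    have hfm : StrictMono f := fun i j hij => by
      have := hzs.strictMono hij
      rwa [← hf i, ← hf j, hxt.strictMono.lt_iff_lt] at this
    have hst : s = t := by
      funext k
      rw [← hf k, strictMono_eq_id hfm]
      rfl
    rw [hst] at hzs hs
    refine hxt.eq_of_gap_le hr hzs fun k => ?_
    have h1 := ((hs k).le.trans (hmin x hx)).trans (hle1 x fun _ => le_rfl)
    rwa [hvt, ← div_eq_mul_inv, div_le_one (hgt k)] at h1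
  obtain ⟨z, hz, hmin⟩ := exists_minimal_nodes hr hab (fun s _ => hv0 s) hvu
  obtain rfl := hmin_eq z hz hmin
  refine hmin_eq y hy fun u hu => ?_
  refine (hle1 y h).trans (le_trans ?_ (hmin u hu))
  have := gap_mul_le hr (fun s _ => hv0 s) hvu z (hxt.1 0)
  rwa [hvt, mul_inv_cancel₀ (hgt 0).ne'] at this

lemma Interlaces.eq_of_weightedNorm_le (hn : 1 ≤ n) (hr : ∀ j, 0 < r j) (hab : a < b)
    (hw0 : ∀ t ∈ Icc a b, 0 ≤ w t) (hw : UpperSemicontinuousOn w (Icc a b))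
    {x y : Fin n → ℝ} {t : Fin (n + 1) → ℝ} (hx : x ∈ closedSimplex n a b)
    (hpos : 0 < weightedNorm a b w (gap r x)) (hxt : Interlaces a b x t)
    (hatt : AttainsNormAt a b w (gap r x) t) (hy : y ∈ closedSimplex n a b)
    (h : weightedNorm a b w (gap r y) ≤ weightedNorm a b w (gap r x)) : y = x := by
  refine hxt.eq_of_gap_le_of_mem_closedSimplex hn hr hab hx hy fun k => ?_
  have hwt : 0 < w (t k) := pos_of_mul_pos_right (hatt k ▸ hpos) (gap_nonneg _ _ _)
  refine le_of_mul_le_mul_right ?_ hwt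
  exact (gap_mul_le hr hw0 hw y (hxt.1 k)).trans (h.trans (hatt k).ge)

lemma openSimplex_of_interlaces {x : Fin n → ℝ} {t : Fin (n + 1) → ℝ}
    (h : Interlaces a b x t) : x ∈ openSimplex n a b := by
  refine ⟨fun i j hij => ?_, fun j => ⟨(h.1 _).1.trans_lt (h.2 j).1, (h.2 j).2.trans_le (h.1 _).2⟩⟩
  have : i.succ ≤ j.castSucc := Fin.succ_le_castSucc_iff.2 hij
  exact (h.2 i).2.trans ((h.strictMono.monotone this).trans_lt (h.2 j).1)

end Uniqueness

/-! ### Log-concave weights -/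

section LogConcave

variable {n : ℕ} {r : Fin n → ℝ} {a b : ℝ} {w : ℝ → ℝ}

lemma sqrt_gap_mul_gap_lt (hn : 1 ≤ n) (hr : ∀ j, 0 < r j) {x : Fin n → ℝ} {s t : ℝ}
    (hst : s < t) (hx : ∀ j, x j < s ∨ t < x j) :
    gap r x s ^ (1 / 2 : ℝ) * gap r x t ^ (1 / 2 : ℝ) < gap r x (1 / 2 * s + 1 / 2 * t) := by
  unfold gap
  rw [← Real.finsetProd_rpow _ _ fun j _ => Real.rpow_nonneg (abs_nonneg _) _,
    ← Real.finsetProd_rpow _ _ fun j _ => Real.rpow_nonneg (abs_nonneg _) _,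
    ← Finset.prod_mul_distrib]
  have hpos : ∀ j, 0 < |s - x j| ∧ 0 < |t - x j| := fun j => by
    constructor <;> refine abs_pos.2 (sub_ne_zero.2 fun e => ?_) <;>
      rcases hx j with h | h <;> linarith
  have key : ∀ j, (|s - x j| ^ r j) ^ (1 / 2 : ℝ) * (|t - x j| ^ r j) ^ (1 / 2 : ℝ) <
      |1 / 2 * s + 1 / 2 * t - x j| ^ r j := fun j => by
    rw [← Real.rpow_mul (abs_nonneg _), ← Real.rpow_mul (abs_nonneg _), mul_comm (r j),
      Real.rpow_mul (abs_nonneg _), Real.rpow_mul (abs_nonneg _),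
      ← Real.mul_rpow (by positivity) (by positivity),
      ← Real.mul_rpow (abs_nonneg _) (abs_nonneg _), ← abs_mul, ← Real.sqrt_eq_rpow]
    refine Real.rpow_lt_rpow (Real.sqrt_nonneg _) ?_ (hr j)
    have hprod : 0 < (s - x j) * (t - x j) := by
      rcases hx j with h | h
      · exact mul_pos (by linarith) (by linarith)
      · exact mul_pos_of_neg_of_neg (by linarith) (by linarith)
    rw [abs_of_pos hprod, ← Real.sqrt_sq_eq_abs]
    refine Real.sqrt_lt_sqrt hprod.le ?_
    -- The squared distance from the midpoint exceeds the product of the two distances by `(t - s) ^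
    -- 2 / 4`.
    nlinarith [mul_pos (sub_pos.2 hst) (sub_pos.2 hst)]
  refine Finset.prod_lt_prod_of_nonempty (fun j _ => ?_) (fun j _ => key j) ⟨⟨0, hn⟩, by simp⟩
  have := hpos j
  have h1 := this.1
  have h2 := this.2
  positivity

/-- For a log-concave weight, consecutive maximum points are separated by a node. -/
lemma exists_node_between (hn : 1 ≤ n) (hr : ∀ j, 0 < r j)
    (hw0 : ∀ t ∈ Icc a b, 0 ≤ w t) (hw : UpperSemicontinuousOn w (Icc a b))
    (hlc : LogConcaveOnIcc a b w) {x : Fin n → ℝ} {s t : ℝ}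
    (hpos : 0 < weightedNorm a b w (gap r x)) (hs : s ∈ Icc a b) (ht : t ∈ Icc a b)
    (hst : s < t) (hs' : gap r x s * w s = weightedNorm a b w (gap r x))
    (ht' : gap r x t * w t = weightedNorm a b w (gap r x)) : ∃ j, s < x j ∧ x j < t := by
  by_contra! hno
  have hws : 0 < w s := pos_of_mul_pos_right (hs' ▸ hpos) (gap_nonneg _ _ _)
  have hwt : 0 < w t := pos_of_mul_pos_right (ht' ▸ hpos) (gap_nonneg _ _ _)
  have hgs : 0 < gap r x s := pos_of_mul_pos_left (hs' ▸ hpos) hws.le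
  have hgt : 0 < gap r x t := pos_of_mul_pos_left (ht' ▸ hpos) hwt.le
  have hx : ∀ j, x j < s ∨ t < x j := fun j => by
    rcases lt_trichotomy (x j) s with h | h | h
    · exact Or.inl h
    · exact absurd h.symm (ne_node_of_gap_pos hr hgs j)
    · exact Or.inr (lt_of_le_of_ne (hno j h) (ne_node_of_gap_pos hr hgt j))
  have hmid : 1 / 2 * s + 1 / 2 * t ∈ Icc a b := by
    constructor <;> linarith [hs.1, hs.2, ht.1, ht.2]
  have h1 := sqrt_gap_mul_gap_lt hn hr hst hx
  have h2 := hlc s hs t ht (1 / 2) (1 / 2) (by norm_num) (by norm_num) (by norm_num)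
  have h3 := gap_mul_le hr hw0 hw x hmid
  have h4 : weightedNorm a b w (gap r x) =
      (gap r x s ^ (1 / 2 : ℝ) * gap r x t ^ (1 / 2 : ℝ)) *
        (w s ^ (1 / 2 : ℝ) * w t ^ (1 / 2 : ℝ)) := by
    have e : weightedNorm a b w (gap r x) =
        (gap r x s * w s) ^ (1 / 2 : ℝ) * (gap r x t * w t) ^ (1 / 2 : ℝ) := by
      rw [hs', ht', ← Real.sqrt_eq_rpow, Real.mul_self_sqrt hpos.le]
    rw [e, Real.mul_rpow hgs.le hws.le, Real.mul_rpow hgt.le hwt.le]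
    ring
  refine absurd (h4.trans_lt ?_) (not_lt.2 h3)
  exact mul_lt_mul h1 h2 (by positivity) (gap_nonneg _ _ _)

/-- Each of the `n` gaps between maximum points contains a node. Choosing one per gap is strictly
increasing on `Fin n`, hence the identity. -/
lemma interlaces_of_logConcave (hn : 1 ≤ n) (hr : ∀ j, 0 < r j)
    (hw0 : ∀ t ∈ Icc a b, 0 ≤ w t) (hw : UpperSemicontinuousOn w (Icc a b))
    (hlc : LogConcaveOnIcc a b w) {x : Fin n → ℝ} (hx : Monotone x)
    (hpos : 0 < weightedNorm a b w (gap r x)) {t : Fin (n + 1) → ℝ} (htm : StrictMono t)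
    (ht : ∀ k, t k ∈ Icc a b) (hatt : AttainsNormAt a b w (gap r x) t) :
    Interlaces a b x t := by
  have key : ∀ k : Fin n, ∃ j, t k.castSucc < x j ∧ x j < t k.succ := fun k =>
    exists_node_between hn hr hw0 hw hlc hpos (ht _) (ht _) (htm (Fin.castSucc_lt_succ))
      (hatt _) (hatt _)
  choose f hf1 hf2 using key
  have hfm : StrictMono f := fun i j hij => by
    refine lt_of_not_ge fun hle => ?_
    have h1 : i.succ ≤ j.castSucc := Fin.succ_le_castSucc_iff.2 hij
    linarith [hx hle, htm.monotone h1, hf2 i, hf1 j]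
  have hid := strictMono_eq_id hfm
  subst hid
  exact ⟨ht, fun j => ⟨hf1 j, hf2 j⟩⟩

end LogConcave

/-! ### The weighted count and the main theorem -/

lemma exists_finset_of_lt_weightedCount {n : ℕ} {a b : ℝ} (hab : a < b) {A : Set ℝ}
    (h : (n : ℝ≥0∞) < weightedCount a b A) :
    ∃ T : Finset ℝ, n < T.card ∧ ∀ t ∈ T, t ∈ Icc a b ∧ t ∈ A := by
  -- Counting the endpoints fully only raises the count.
  have h1 : weightedCount a b A ≤ ((A ∩ Icc a b).encard : ℝ≥0∞) := by
    have hU : A ∩ Icc a b = A ∩ Ioo a b ∪ A ∩ {a, b} := by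
      rw [← inter_union_distrib_left, Ioo_union_both hab.le]
    have hdis : Disjoint (A ∩ Ioo a b) (A ∩ {a, b}) := by
      refine disjoint_left.2 fun t ht ht' => ?_
      rcases ht'.2 with e | e
      · exact ht.2.1.ne' e
      · exact ht.2.2.ne e
    rw [hU, encard_union_eq hdis]
    push_cast
    exact add_le_add_right ENNReal.half_le_self _
  have h2 : (n : ℕ∞) < (A ∩ Icc a b).encard := by
    have := h.trans_le h1
    exact_mod_cast this
  obtain ⟨S, hS, hcard⟩ := exists_subset_encard_eq (Order.add_one_le_of_lt h2)
  have hfin : S.Finite := finite_of_encard_eq_coe (k := n + 1) (by simpa using hcard)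
  refine ⟨hfin.toFinset, ?_, fun t ht => ?_⟩
  · rw [hfin.encard_eq_coe_toFinset_card] at hcard
    have : hfin.toFinset.card = n + 1 := by exact_mod_cast hcard
    omega
  · have := hS (hfin.mem_toFinset.1 ht)
    exact ⟨this.2, this.1⟩

end

theorem mainTheorem6 (n : ℕ) (hn : 1 ≤ n) (r : Fin n → ℝ) (hr : ∀ j, 0 < r j)
    (a b : ℝ) (hab : a < b) (w : ℝ → ℝ)
    (hw_nonneg : ∀ t ∈ Icc a b, 0 ≤ w t)
    (hw_usc : UpperSemicontinuousOn w (Icc a b))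
    (hw_count : (n : ℝ≥0∞) < weightedCount a b {t | w t ≠ 0}) :
    chebyshevConstant a b w (unrestrictedGAP r) =
        chebyshevConstant a b w (restrictedGAP r a b) ∧
    ∃ xs ∈ openSimplex n a b,
      -- `gap r xs` is the only extremal element, in the restricted and the unrestricted class
      (∀ P : ℝ → ℝ, IsExtremalIn a b w (restrictedGAP r a b) P ↔ P = gap r xs) ∧
      (∀ P : ℝ → ℝ, IsExtremalIn a b w (unrestrictedGAP r) P ↔ P = gap r xs) ∧
      -- `xs` is the only extremal node system
      (∀ x ∈ closedSimplex n a b,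
        IsExtremalIn a b w (restrictedGAP r a b) (gap r x) ↔ x = xs) ∧
      -- `xs` is the only node system with the interlacing attainment property
      (∀ x ∈ closedSimplex n a b,
        (∃ t : Fin (n + 1) → ℝ, Interlaces a b x t ∧ AttainsNormAt a b w (gap r x) t) ↔
          x = xs) ∧
      -- for log-concave weights, attainment at any `n + 1` points characterizes `xs`
      (LogConcaveOnIcc a b w →
        ∀ x ∈ closedSimplex n a b,
          (∃ t : Fin (n + 1) → ℝ, StrictMono t ∧ (∀ k, t k ∈ Icc a b) ∧
            AttainsNormAt a b w (gap r x) t) ↔ x = xs) := by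
  obtain ⟨T, hT, hTw⟩ := exists_finset_of_lt_weightedCount hab hw_count
  have hpos : ∀ x, 0 < weightedNorm a b w (gap r x) :=
    weightedNorm_gap_pos hr hw_nonneg hw_usc hT fun t ht =>
      ⟨(hTw t ht).1, (hw_nonneg t (hTw t ht).1).lt_of_ne' (hTw t ht).2⟩
  obtain ⟨xs, hxs, hmin⟩ := exists_minimal_nodes hr hab hw_nonneg hw_usc
  obtain ⟨ts, hts, hats⟩ :=
    exists_interlaces_of_minimal hn hr hab hw_nonneg hw_usc (hpos xs) hxs.1 hmin
  have huniq : ∀ y ∈ closedSimplex n a b,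
      weightedNorm a b w (gap r y) ≤ weightedNorm a b w (gap r xs) → y = xs := fun y hy hle =>
    hts.eq_of_weightedNorm_le hn hr hab hw_nonneg hw_usc hxs (hpos xs) hats hy hle
  -- Here the roles are exchanged: `x` carries the interlacing system and the minimizer `xs` is the
  -- competitor.
  have hinter : ∀ x ∈ closedSimplex n a b, ∀ t : Fin (n + 1) → ℝ, Interlaces a b x t →
      AttainsNormAt a b w (gap r x) t → x = xs := fun x hx t hxt hatt =>
    (hxt.eq_of_weightedNorm_le hn hr hab hw_nonneg hw_usc hx (hpos x) hatt hxs (hmin x hx)).symm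
  have hmemR : gap r xs ∈ restrictedGAP r a b := ⟨xs, hxs, rfl⟩
  have hmemU : gap r xs ∈ unrestrictedGAP r := ⟨xs, 0, hxs.1, (complexGap_zero r xs).symm⟩
  have hexR : IsExtremalIn a b w (restrictedGAP r a b) (gap r xs) := by
    refine ⟨hmemR, ?_⟩
    rintro _ ⟨y, hy, rfl⟩
    exact hmin y hy
  have hexU : IsExtremalIn a b w (unrestrictedGAP r) (gap r xs) := by
    refine ⟨hmemU, ?_⟩
    rintro _ ⟨y, z, hy, rfl⟩
    exact weightedNorm_gap_le_complexGap hr hab hw_nonneg hw_usc hmin hy z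
  have hconst : ∀ F : Set (ℝ → ℝ), IsExtremalIn a b w F (gap r xs) →
      chebyshevConstant a b w F = weightedNorm a b w (gap r xs) := fun F hF =>
    IsLeast.csInf_eq ⟨mem_image_of_mem _ hF.1, by rintro _ ⟨Q, hQ, rfl⟩; exact hF.2 Q hQ⟩
  refine ⟨(hconst _ hexU).trans (hconst _ hexR).symm, xs, openSimplex_of_interlaces hts,
    fun P => ⟨?_, fun h => h ▸ hexR⟩, fun P => ⟨?_, fun h => h ▸ hexU⟩, fun x hx => ⟨?_, ?_⟩,
    fun x hx => ⟨?_, ?_⟩, fun hlc x hx => ⟨?_, ?_⟩⟩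
  · rintro ⟨⟨x, hx, rfl⟩, hP⟩
    rw [huniq x hx (hP _ hmemR)]
  · rintro ⟨⟨x, y, hx, rfl⟩, hP⟩
    have hle := hP _ hmemU
    have hproj := projIcc_mem_closedSimplex hab.le hx
    obtain ⟨hmem, rfl⟩ := real_zeros_of_weightedNorm_le hr hab hw_nonneg hw_usc (hpos _)
      (hle.trans (hmin _ hproj))
    rw [complexGap_zero] at hle ⊢
    rw [huniq x ⟨hx, hmem⟩ hle]
  · exact fun h => huniq x hx (h.2 _ hmemR)
  · exact fun h => h ▸ hexR
  · rintro ⟨t, hxt, hatt⟩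
    exact hinter x hx t hxt hatt
  · rintro rfl
    exact ⟨ts, hts, hats⟩
  · rintro ⟨t, htm, ht, hatt⟩
    exact hinter x hx t
      (interlaces_of_logConcave hn hr hw_nonneg hw_usc hlc hx.1 (hpos x) htm ht hatt) hatt
  · rintro rfl
    exact ⟨ts, hts.strictMono, hts.1, hats⟩
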